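/- Let $3\le\alpha<\omega$. For a set $U$, consider on subsets $X,Y$ of $U^\alpha$ the operations $X+Y=X\cup Y$, $-X=U^\alpha\setminus X$, and, for $i,j<\alpha$, the cylindrification $C_iX=\{u\in U^\alpha : \exists u'\in X\ \forall l\neq i\ (u_l=u'_l)\}$, the diagonal constant $D_{ij}=\{u\in U^\alpha: u_i=u_j\}$, and the transposition $P_{ij}X=\{u\in U^\alpha: \exists u'\in X\ (u_i=u'_j,\ u_j=u'_i,\ u_l=u'_l \text{ for all } l\ne i,j)\}$. Let $Pse_\alpha$ be the class of all algebras $\langle A,+,-,C_i,D_{ij},P_{ij}\rangle_{i,j<\alpha}$, where, for some set $U$, $A$ is a family of subsets of $U^\alpha$ that is closed under these operations and contains all $D_{ij}$; let $Cs_\alpha$ be the class of algebras $\langle A,+,-,C_i,D_{ij}\rangle_{i,j<\alpha}$ defined in the same way without the operations $P_{ij}$. The corresponding operation symbols are $+,-,c_i,d_{ij},p_{ij}$. An equational axiom set for $Pse_\alpha$ is a set of equations true in $Pse_\alpha$ from which all equations true in $Pse_\alpha$ are derivable (in equational logic). Then every equational axiom set $E$ for $Pse_\alpha$ contains equations $e_n$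 $(n<\omega)$ such that, for each $n$, more than $n$ distinct algebraic variables occur in $e_n$ together with some transposition $p_{ij}$, some diagonal constant $d_{kl}$ and some cylindrification $c_m$ (where $i,j,k,l,m<\alpha$). Moreover, $Pse_\alpha$ is not finitely axiomatizable over $Cs_\alpha$: there is no finite set $F$ of equations such that the equations true in $Pse_\alpha$ are exactly those derivable from $F$ together with all equations true in $Cs_\alpha$. -/

import Mathlib

open scoped FirstOrder

universe u v w

namespace EqLogic

/-- An equation `lhs = rhs` between terms of the language `L`, whose algebraic variables are
indexed by `ℕ`. -/
structure Equation (L : FirstOrder.Language.{u, v}) where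
  /-- the left-hand side -/
  lhs : L.Term ℕ
  /-- the right-hand side -/
  rhs : L.Term ℕ

/-- The equation `e` is true in the algebra `M`: both sides agree under every evaluation. -/
def Holds {L : FirstOrder.Language.{u, v}} (M : Type w) [L.Structure M] (e : Equation L) : Prop :=
  ∀ x : ℕ → M, e.lhs.realize x = e.rhs.realize x

/-- Derivability from a set `E` of equations by the rules of equational logic. -/
inductive Derives {L : FirstOrder.Language.{u, v}} (E : Set (Equation L)) : L.Term ℕ → L.Term ℕ → Prop
  | ax (e : Equation L) : e ∈ E → Derives E e.lhs e.rhs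
  | refl (t : L.Term ℕ) : Derives E t t
  | symm {s t : L.Term ℕ} : Derives E s t → Derives E t s
  | trans {r s t : L.Term ℕ} : Derives E r s → Derives E s t → Derives E r t
  | cong {n : ℕ} (f : L.Functions n) (s t : Fin n → L.Term ℕ) :
      (∀ k, Derives E (s k) (t k)) → Derives E (FirstOrder.Language.Term.func f s) (FirstOrder.Language.Term.func f t)
  | subst {s t : L.Term ℕ} (σ : ℕ → L.Term ℕ) :
      Derives E s t → Derives E (s.subst σ) (t.subst σ)

/-- The equation `e` is derivable from the set `E` of equations. -/
def Derivable {L : FirstOrder.Language.{u, v}} (E : Set (Equation L)) (e : Equation L) : Prop :=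
  Derives E e.lhs e.rhs

/-- The operation symbol `f` occurs in a term. -/
def TermUses {L : FirstOrder.Language.{u, v}} {n : ℕ} (f : L.Functions n) : L.Term ℕ → Prop
  | FirstOrder.Language.Term.var _ => False
  | @FirstOrder.Language.Term.func _ _ m g ts =>
      (⟨m, g⟩ : Σ k, L.Functions k) = ⟨n, f⟩ ∨ ∃ k, TermUses f (ts k)

/-- The operation symbol `f` occurs in the equation `e`. -/
def Equation.Uses {L : FirstOrder.Language.{u, v}} {n : ℕ} (e : Equation L) (f : L.Functions n) : Prop :=
  TermUses f e.lhs ∨ TermUses f e.rhs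

/-- The finite set of algebraic variables that occur in the equation `e`. -/
def Equation.vars {L : FirstOrder.Language.{u, v}} (e : Equation L) : Finset ℕ :=
  e.lhs.varFinset ∪ e.rhs.varFinset

/-- Translation of an equation along an interpretation of operation symbols. -/
def Equation.map {L : FirstOrder.Language.{u, v}} {L' : FirstOrder.Language.{u, v}} (φ : L →ᴸ L') (e : Equation L) :
    Equation L' :=
  ⟨φ.onTerm e.lhs, φ.onTerm e.rhs⟩

end EqLogic

namespace SetAlgebra

open EqLogic

/-- The operation symbols `+, -, c_i, d_ij` of cylindric-type algebras of dimension `α`. -/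
inductive CylOp (α : ℕ) : ℕ → Type
  | add : CylOp α 2
  | neg : CylOp α 1
  | c (i : Fin α) : CylOp α 1
  | d (i j : Fin α) : CylOp α 0

/-- The operation symbols `+, -, c_i, d_ij, p_ij` of polyadic-type algebras of dimension `α`. -/
inductive PolOp (α : ℕ) : ℕ → Type
  | add : PolOp α 2
  | neg : PolOp α 1
  | c (i : Fin α) : PolOp α 1
  | d (i j : Fin α) : PolOp α 0
  | p (i j : Fin α) : PolOp α 1

/-- The algebraic language of `Cs_α`. -/
def cylLang (α : ℕ) : FirstOrder.Language.{0, 0} := ⟨CylOp α, fun _ => Empty⟩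

/-- The algebraic language of `Pse_α`. -/
def polLang (α : ℕ) : FirstOrder.Language.{0, 0} := ⟨PolOp α, fun _ => Empty⟩

/-- Each operation symbol of `Cs_α` is an operation symbol of `Pse_α`. -/
def cylToPol (α : ℕ) : cylLang α →ᴸ polLang α where
  onFunction := fun {_} f => match f with
    | .add => PolOp.add
    | .neg => PolOp.neg
    | .c i => PolOp.c i
    | .d i j => PolOp.d i j
  onRelation := fun {_} r => Empty.elim r

/-- The cylindrification `C_i^U`. -/
def cylindrification {α : ℕ} {U : Type u} (i : Fin α) (X : Set (Fin α → U)) :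
    Set (Fin α → U) :=
  {a | ∃ b ∈ X, ∀ j, j ≠ i → a j = b j}

/-- The diagonal constant `D_ij^U`. -/
def diagonal {α : ℕ} (U : Type u) (i j : Fin α) : Set (Fin α → U) :=
  {a | a i = a j}

/-- The polyadic transposition operation `P_ij`. -/
def transposition {α : ℕ} {U : Type u} (i j : Fin α) (X : Set (Fin α → U)) :
    Set (Fin α → U) :=
  {a | ∃ b ∈ X, a i = b j ∧ a j = b i ∧ ∀ l, l ≠ i → l ≠ j → a l = b l}

/-- The algebra of all subsets of `U^α` with the cylindric operations. -/
instance fullCs (α : ℕ) (U : Type u) : (cylLang α).Structure (Set (Fin α → U)) where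
  funMap := fun {_} f => match f with
    | .add => fun X => X 0 ∪ X 1
    | .neg => fun X => (X 0)ᶜ
    | .c i => fun X => cylindrification i (X 0)
    | .d i j => fun _ => diagonal U i j
  RelMap := fun {_} r => Empty.elim r

/-- The algebra of all subsets of `U^α` with the polyadic equality operations. -/
instance fullPse (α : ℕ) (U : Type u) : (polLang α).Structure (Set (Fin α → U)) where
  funMap := fun {_} f => match f with
    | .add => fun X => X 0 ∪ X 1
    | .neg => fun X => (X 0)ᶜ
    | .c i => fun X => cylindrification i (X 0)
    | .d i j => fun _ => diagonal U i j
    | .p i j => fun X => transposition i j (X 0)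
  RelMap := fun {_} r => Empty.elim r

/-- A cylindric set algebra of dimension `α` with base set `U`: a family of subsets of `U^α`
that is closed under the operations and contains the constants. -/
abbrev Cs (α : ℕ) (U : Type u) := (cylLang α).Substructure (Set (Fin α → U))

/-- A polyadic equality set algebra of dimension `α` with base set `U`: a family of subsets of
`U^α` that is closed under the operations and contains the constants. -/
abbrev Pse (α : ℕ) (U : Type u) := (polLang α).Substructure (Set (Fin α → U))

/-- The set of equations true in (all members of) `Cs_α`. -/
def csTheory (α : ℕ) : Set (Equation (cylLang α)) :=
  {e | ∀ (U : Type u) (A : Cs α U), Holds A e}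

/-- The set of equations true in (all members of) `Pse_α`. -/
def pseTheory (α : ℕ) : Set (Equation (polLang α)) :=
  {e | ∀ (U : Type u) (A : Pse α U), Holds A e}

/-- `E` is an equational axiom set for `Pse_α`: its members are true in `Pse_α`, and all equations
true in `Pse_α` are derivable from it. -/
def IsEquationalAxiomSet (α : ℕ) (E : Set (Equation (polLang α))) : Prop :=
  E ⊆ pseTheory.{u} α ∧ ∀ e ∈ pseTheory.{u} α, Derivable E e

/-- `Pse_α` is finitely axiomatizable over `Cs_α`: for some finite set `F` of equations, the
equations true in `Pse_α` are exactly those derivable from `F` together with all equations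
true in `Cs_α`. -/
def FinitelyAxiomatizableOverCs (α : ℕ) : Prop :=
  ∃ F : Set (Equation (polLang α)), F.Finite ∧
    ∀ e, e ∈ pseTheory.{u} α ↔
      Derivable (F ∪ Equation.map (cylToPol α) '' csTheory.{u} α) e

end SetAlgebra

/-!
Regard a binary relation on the first two coordinates as a class of edges. If `k > 0` is even, no
`k` disjoint graphs on at most `k + 1` vertices can reach every vertex: each of them would be a
perfect matching of exactly `k + 1` vertices. This fact is an equation of set algebras. It fails in
an algebra of sets of sequences over `k + 1` points and further labels, where the sequences of two
distinct points followed by labels carry an additional colour in `ZMod k` that the cylindrifications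
forget. On the other hand, an equation of set algebras holds there as soon as the colour can be
imitated by a function `χ` of the sequence:
* without diagonal constants, the elements of the base set may be split into coloured copies, and
  `χ` adds the colours of the coordinates;
* without cylindrifications, `χ` need not take all values when a single coordinate varies, and may
  add the labels only;
* without transpositions, `χ` may add the difference of the two points, taken in the order of their
  coordinates, which is not zero and so takes `k` values;
* with few variables, only few classes of colours are distinguished, and each of them is attained by
  two values of the sum of the coordinates, one of which avoids a repeated point.
-/

namespace EqLogic

open FirstOrder.Language

variable {L : FirstOrder.Language.{u, v}} {A B : Type*} [L.Structure A] [L.Structure B]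

theorem Derives.realize_eq {E : Set (Equation L)} (hE : ∀ e ∈ E, Holds A e) {s t : L.Term ℕ}
    (h : Derives E s t) (x : ℕ → A) : s.realize x = t.realize x := by
  induction h generalizing x with
  | ax e he => exact hE e he x
  | refl => rfl
  | symm _ ih => exact (ih x).symm
  | trans _ _ ih₁ ih₂ => exact (ih₁ x).trans (ih₂ x)
  | cong f s t _ ih => exact congrArg (Structure.funMap f) (funext fun i => ih i x)
  | subst σ _ ih => simpa only [Term.realize_subst] using ih _

/-- The map `φ` commutes with the single operation `f`. -/
def Commutes (φ : A → B) {n : ℕ} (f : L.Functions n) : Prop :=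
  ∀ x : Fin n → A, φ (Structure.funMap f x) = Structure.funMap f (φ ∘ x)

theorem map_realize {φ : A → B} {t : L.Term ℕ}
    (hφ : ∀ (n : ℕ) (f : L.Functions n), TermUses f t → Commutes φ f) (x : ℕ → A) :
    φ (t.realize x) = t.realize (φ ∘ x) := by
  induction t with
  | var v => rfl
  | func f ts ih =>
    refine (hφ _ f (Or.inl rfl) _).trans (congrArg (Structure.funMap f) (funext fun i => ?_))
    exact ih i fun n g hg => hφ n g (Or.inr ⟨i, hg⟩)

theorem Holds.of_injective {φ : A → B} {e : Equation L} (he : Holds B e)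
    (hφ : Function.Injective φ)
    (hcomm : ∀ (n : ℕ) (f : L.Functions n), e.Uses f → Commutes φ f) : Holds A e := by
  refine fun x => hφ ?_
  rw [map_realize (fun n f hf => hcomm n f (Or.inl hf)),
    map_realize (fun n f hf => hcomm n f (Or.inr hf))]
  exact he _

theorem realize_congr {t : L.Term ℕ} {x y : ℕ → A} (h : ∀ v ∈ t.varFinset, x v = y v) :
    t.realize x = t.realize y := by
  induction t with
  | var v => exact h v (Finset.mem_singleton_self v)
  | func f ts ih =>
    refine congrArg (Structure.funMap f) (funext fun i => ih i fun v hv => h v ?_)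
    exact Finset.mem_biUnion.2 ⟨i, Finset.mem_univ i, hv⟩

theorem Holds.realize_eq_of_mem {S : L.Substructure A} [Nonempty S] {e : Equation L}
    (he : Holds S e) {x : ℕ → A} (hx : ∀ v ∈ e.vars, x v ∈ S) :
    e.lhs.realize x = e.rhs.realize x := by
  classical
  let y : ℕ → S := fun v => if h : x v ∈ S then ⟨x v, h⟩ else Classical.arbitrary S
  have hy : ∀ v ∈ e.vars, x v = (y v : A) := fun v hv => by simp only [y, dif_pos (hx v hv)]
  calc e.lhs.realize x
      = e.lhs.realize ((↑) ∘ y) :=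
        realize_congr fun v hv => hy v (Finset.mem_union_left _ hv)
    _ = e.rhs.realize ((↑) ∘ y) := by simp only [realize_term_substructure, he y]
    _ = e.rhs.realize x :=
        (realize_congr fun v hv => hy v (Finset.mem_union_right _ hv)).symm

end EqLogic

namespace SetAlgebra

open EqLogic FirstOrder.Language

theorem mem_pseTheory {α : ℕ} {e : Equation (polLang α)} :
    e ∈ pseTheory.{u} α ↔ ∀ U : Type u, Holds (Set (Fin α → U)) e :=
  ⟨fun h U => (h U ⊤).of_injective (φ := fun X => ⟨X, trivial⟩)
      (fun _ _ => congrArg Subtype.val) fun _ _ _ _ => rfl,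
    fun h U _ => (h U).of_injective Subtype.val_injective fun _ _ _ _ => rfl⟩

theorem mem_cylindrification {α : ℕ} {U : Type u} {i : Fin α} {X : Set (Fin α → U)}
    {a : Fin α → U} : a ∈ cylindrification i X ↔ ∃ y, Function.update a i y ∈ X := by
  constructor
  · rintro ⟨b, hb, h⟩
    exact ⟨b i, (Function.update_eq_iff.2 ⟨rfl, h⟩).symm ▸ hb⟩
  · rintro ⟨y, hy⟩
    exact ⟨_, hy, fun j hj => (Function.update_of_ne hj _ _).symm⟩

theorem mem_transposition {α : ℕ} {U : Type u} {i j : Fin α} {X : Set (Fin α → U)}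
    {a : Fin α → U} : a ∈ transposition i j X ↔ a ∘ Equiv.swap i j ∈ X := by
  constructor
  · rintro ⟨b, hb, hi, hj, h⟩
    have hab : a ∘ Equiv.swap i j = b := by
      rw [Equiv.comp_swap_eq_update, hi, hj]
      refine Function.update_eq_iff.2 ⟨rfl, fun l hl => ?_⟩
      rcases eq_or_ne l j with rfl | hlj
      · simp only [Function.update_self]
      · rw [Function.update_of_ne hlj, h l hl hlj]
    exact hab ▸ hb
  · intro h
    exact ⟨_, h, by simp, by simp, fun l hi hj => by simp [Equiv.swap_apply_of_ne_of_ne hi hj]⟩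

/-- The algebra of all subsets of `M^α × J`: sequences carry a colour from `J`, which the
cylindrifications forget and the transpositions preserve. -/
instance colouredAlgebra (α : ℕ) (M : Type u) (J : Type v) :
    (polLang α).Structure (Set ((Fin α → M) × J)) where
  funMap := fun {_} f => match f with
    | .add => fun X => X 0 ∪ X 1
    | .neg => fun X => (X 0)ᶜ
    | .c i => fun X => {p | ∃ y j, (Function.update p.1 i y, j) ∈ X 0}
    | .d i j => fun _ => {p | p.1 i = p.1 j}
    | .p i j => fun X => {p | (p.1 ∘ Equiv.swap i j, p.2) ∈ X 0}
  RelMap := fun {_} r => Empty.elim r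

section Colouring

variable {k : ℕ}

open Classical in
theorem sum_degree_le_of_pairwise_disjoint {V ι : Type*} [Fintype V] [Fintype ι]
    {G : ι → SimpleGraph V} (hG : Pairwise (Function.onFun Disjoint G)) (v : V) :
    ∑ l, (G l).degree v ≤ Fintype.card V - 1 := by
  have hdisj : ∀ l ∈ Finset.univ, ∀ l' ∈ Finset.univ, l ≠ l' →
      Disjoint ((G l).neighborFinset v) ((G l').neighborFinset v) := by
    intro l _ l' _ hl
    refine Finset.disjoint_left.2 fun w h h' => ?_
    simp only [SimpleGraph.mem_neighborFinset] at h h'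
    exact (SimpleGraph.disjoint_left.1 (hG hl)) v w h h'
  calc ∑ l, (G l).degree v
      = (Finset.univ.biUnion fun l => (G l).neighborFinset v).card :=
        (Finset.card_biUnion hdisj).symm
    _ ≤ (Finset.univ.erase v).card := Finset.card_le_card fun w hw => by
        simp only [Finset.mem_biUnion, SimpleGraph.mem_neighborFinset] at hw
        obtain ⟨l, -, hl⟩ := hw
        exact Finset.mem_erase.2 ⟨hl.ne', Finset.mem_univ w⟩
    _ = Fintype.card V - 1 := Finset.card_erase_of_mem (Finset.mem_univ v)

theorem add_one_lt_card_of_pairwise_disjoint {V : Type*} [Fintype V] [Nonempty V]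
    {G : Fin k → SimpleGraph V} (hG : Pairwise (Function.onFun Disjoint G))
    (hadj : ∀ l v, ∃ w, (G l).Adj v w) (hk : Even k) (hk0 : k ≠ 0) :
    k + 1 < Fintype.card V := by
  classical
  by_contra! hcard
  have hdeg : ∀ v, ∀ l ∈ Finset.univ, 1 ≤ (G l).degree v := fun v l _ =>
    Nat.succ_le_of_lt (((G l).degree_pos_iff_exists_adj v).2 (hadj l v))
  have hk_le : ∀ v, k ≤ ∑ l, (G l).degree v := fun v => by
    simpa using Finset.sum_le_sum (hdeg v)
  have hle := fun v => sum_degree_le_of_pairwise_disjoint hG v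
  have hdeg_one : ∀ l v, (G l).degree v = 1 := fun l v => by
    refine ((Finset.sum_eq_sum_iff_of_le (hdeg v)).1 ?_ l (Finset.mem_univ l)).symm
    have := hk_le v
    have := hle v
    simp only [Finset.sum_const, Finset.card_univ, Fintype.card_fin, smul_eq_mul]
    omega
  have hcard_eq : Fintype.card V = k + 1 := by
    have v := Classical.arbitrary V
    have := hk_le v
    have := hle v
    omega
  have hhandshake := (G ⟨0, Nat.pos_of_ne_zero hk0⟩).sum_degrees_eq_twice_card_edges
  simp only [hdeg_one, Finset.sum_const, Finset.card_univ, smul_eq_mul, mul_one] at hhandshake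
  obtain ⟨r, rfl⟩ := hk
  omega

/-- The relations `R 0, …, R (k - 1)` are the colour classes of a proper edge colouring in which a
vertex reached by one colour is reached by every colour, and the sets `T 0, …, T k`, with at most
one element each, cover the vertices. -/
structure IsBoundedColouring {U : Type*} (k : ℕ) (R : ℕ → U → U → Prop) (T : ℕ → U → Prop) :
    Prop where
  disjoint : ∀ l < k, ∀ l' < l, ∀ a b, R l a b → ¬ R l' a b
  complete : ∀ l < k, ∀ l' < k, ∀ a b, R l a b → ∃ a', R l' a' b
  irrefl : ∀ l < k, ∀ a b, R l a b → a ≠ b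
  symm : ∀ l < k, ∀ a b, R l a b → R l b a
  subsingleton : ∀ i < k + 1, ∀ a a', T i a → T i a' → a = a'
  bounded : ∀ a b, R 0 a b → ∃ i < k + 1, T i a

namespace IsBoundedColouring

variable {U : Type*} {R : ℕ → U → U → Prop} {T : ℕ → U → Prop}

/-- The graph of the edges of colour `l`, on the vertices with an edge of colour `0`. -/
def graph (h : IsBoundedColouring k R T) (l : Fin k) : SimpleGraph {a // ∃ b, R 0 a b} where
  Adj a b := R l a b
  symm := ⟨fun a b => h.symm l l.2 a b⟩
  loopless := ⟨fun a hl => h.irrefl l l.2 a a hl rfl⟩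

theorem pairwise_disjoint_graph (h : IsBoundedColouring k R T) :
    Pairwise (Function.onFun Disjoint h.graph) := by
  refine fun l l' hl => SimpleGraph.disjoint_left.2 fun a b hab hab' => ?_
  rcases lt_or_gt_of_ne hl with hlt | hlt
  · exact h.disjoint l' l'.2 l hlt a b hab' hab
  · exact h.disjoint l l.2 l' hlt a b hab hab'

theorem exists_adj_graph (h : IsBoundedColouring k R T) (l : Fin k) (a : {a // ∃ b, R 0 a b}) :
    ∃ b, (h.graph l).Adj a b := by
  obtain ⟨a, b, hab⟩ := a
  have h0 : 0 < k := l.pos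
  obtain ⟨c, hc⟩ := h.complete 0 h0 l l.2 b a (h.symm 0 h0 a b hab)
  obtain ⟨e, he⟩ := h.complete l l.2 0 h0 a c (h.symm l l.2 c a hc)
  exact ⟨⟨c, e, h.symm 0 h0 e c he⟩, h.symm l l.2 c a hc⟩

theorem exists_injective (h : IsBoundedColouring k R T) :
    ∃ f : {a // ∃ b, R 0 a b} → Fin (k + 1), Function.Injective f := by
  choose f hf hTf using fun a : {a // ∃ b, R 0 a b} => h.bounded a.1 a.2.choose a.2.choose_spec
  refine ⟨fun a => ⟨f a, hf a⟩, fun a b hab => Subtype.ext ?_⟩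
  have hfab : f a = f b := congrArg Fin.val hab
  exact h.subsingleton (f a) (hf a) a b (hTf a) (hfab ▸ hTf b)

theorem not_rel (h : IsBoundedColouring k R T) (hk : Even k) (hk0 : k ≠ 0) (a b : U) :
    ¬ R 0 a b := by
  intro hab
  obtain ⟨f, hf⟩ := h.exists_injective
  have := Fintype.ofInjective f hf
  have : Nonempty {a // ∃ b, R 0 a b} := ⟨⟨a, b, hab⟩⟩
  have hcard := add_one_lt_card_of_pairwise_disjoint h.pairwise_disjoint_graph
    h.exists_adj_graph hk hk0
  exact absurd (Fintype.card_le_of_injective f hf) (by simpa using hcard)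

end IsBoundedColouring

end Colouring

section Orbits

/-- The base set of the algebras below: the points `ZMod m`, the permutations of the points, and
`d + 1` sorts of integer labels. -/
inductive Base (m d : ℕ) : Type u
  | point (a : ZMod m) : Base m d
  | perm (z : Equiv.Perm (ZMod m)) : Base m d
  | label (l : Fin (d + 1)) (x : ℤ) : Base m d

/-- The group of automorphisms of the base set that come from permutations of the points and of the
labels of each sort. -/
abbrev Base.Aut (m d : ℕ) : Type := Equiv.Perm (ZMod m) × (Fin (d + 1) → Equiv.Perm ℤ)

variable {m d : ℕ}

/-- The action of the automorphisms on the base set. On the permutations of the points it is chosen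
so that the value of a permutation at a point is invariant: `(z * g.1⁻¹) (g.1 a) = z a`. -/
instance Base.mulAction : MulAction (Base.Aut m d) (Base.{u} m d) where
  smul g
    | .point a => .point (g.1 a)
    | .perm z => .perm (z * g.1⁻¹)
    | .label l x => .label l (g.2 l x)
  one_smul y := by
    cases y with
    | perm z => exact congrArg Base.perm (by simp)
    | _ => rfl
  mul_smul g h y := by
    cases y with
    | perm z => exact congrArg Base.perm (by simp [mul_assoc])
    | _ => rfl

/-- The sequence of the points `a`, `b` followed by the labels `x`, one of each sort. -/
def canon (a b : ZMod m) (x : Fin (d + 1) → ℤ) : Fin (d + 3) → Base.{u} m d :=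
  Fin.cons (.point a) (Fin.cons (.point b) fun l => .label l (x l))

theorem smul_canon (g : Base.Aut m d) (a b : ZMod m) (x : Fin (d + 1) → ℤ) :
    g • canon.{u} a b x = canon (g.1 a) (g.1 b) fun l => g.2 l (x l) :=
  funext (Fin.cases rfl (Fin.cases rfl fun _ => rfl))

theorem update_canon_zero (a b a' : ZMod m) (x : Fin (d + 1) → ℤ) :
    Function.update (canon.{u} a b x) 0 (.point a') = canon a' b x :=
  Fin.update_cons_zero _ _ _

theorem update_canon_one (a b b' : ZMod m) (x : Fin (d + 1) → ℤ) :
    Function.update (canon.{u} a b x) 1 (.point b') = canon a b' x :=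
  (Fin.cons_update _ _ 0 _).symm.trans (congrArg _ (Fin.update_cons_zero _ _ _))

theorem update_canon_label (a b : ZMod m) (x : Fin (d + 1) → ℤ) (l : Fin (d + 1)) (y : ℤ) :
    Function.update (canon.{u} a b x) l.succ.succ (.label l y) =
      canon a b (Function.update x l y) := by
  simp only [canon, ← Fin.cons_update]
  exact congrArg (fun w => Fin.cons _ (Fin.cons _ w)) (funext fun l' =>
    (Function.apply_update (fun l => Base.label.{u} (m := m) l) x l y l').symm)

theorem canon_comp_swap (a b : ZMod m) (x : Fin (d + 1) → ℤ) :
    canon.{u} a b x ∘ Equiv.swap 0 1 = canon b a x := by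
  rw [Equiv.comp_swap_eq_update]
  exact (congrArg (Function.update · 0 _) (update_canon_one a b a x)).trans
    (update_canon_zero a a b x)

/-- The sequences that, up to the permutation `σ` of the coordinates, consist of two distinct points
followed by a label of each sort. For fixed `σ` they form one orbit of `Base.Aut m d`. -/
def Regular (σ : Equiv.Perm (Fin (d + 3))) (u : Fin (d + 3) → Base.{u} m d) : Prop :=
  ∃ a b x, a ≠ b ∧ u = canon a b x ∘ σ

theorem regular_canon_comp {σ : Equiv.Perm (Fin (d + 3))} {a b : ZMod m} (hab : a ≠ b)
    (x : Fin (d + 1) → ℤ) : Regular σ (canon.{u} a b x ∘ σ) :=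
  ⟨a, b, x, hab, rfl⟩

theorem Regular.smul {σ : Equiv.Perm (Fin (d + 3))} {u : Fin (d + 3) → Base.{u} m d}
    (h : Regular σ u) (g : Base.Aut m d) : Regular σ (g • u) := by
  obtain ⟨a, b, x, hab, rfl⟩ := h
  exact ⟨_, _, _, g.1.injective.ne hab, congrArg (· ∘ σ) (smul_canon g a b x)⟩

theorem Regular.exists_smul_eq {σ : Equiv.Perm (Fin (d + 3))} {u u' : Fin (d + 3) → Base.{u} m d}
    (h : Regular σ u) (h' : Regular σ u') : ∃ g : Base.Aut m d, g • u = u' := by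
  obtain ⟨a, b, x, hab, rfl⟩ := h
  obtain ⟨a', b', x', hab', rfl⟩ := h'
  obtain ⟨π, rfl, rfl⟩ := MulAction.is_two_pretransitive_iff.1
    (Equiv.Perm.isMultiplyPretransitive (ZMod m) 2) hab hab'
  refine ⟨(π, fun l => Equiv.swap (x l) (x' l)), ?_⟩
  refine (congrArg (· ∘ σ) (smul_canon _ a b x)).trans ?_
  simp only [Equiv.swap_apply_left, Equiv.Perm.smul_def]

theorem Regular.of_comp_swap {σ : Equiv.Perm (Fin (d + 3))} {i j : Fin (d + 3)}
    {u : Fin (d + 3) → Base.{u} m d} (h : Regular σ (u ∘ Equiv.swap i j)) :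
    Regular (σ * Equiv.swap i j) u := by
  obtain ⟨a, b, x, hab, hu⟩ := h
  refine ⟨a, b, x, hab, ?_⟩
  rw [Equiv.Perm.coe_mul, ← Function.comp_assoc, ← hu, Function.comp_assoc, ← Equiv.Perm.coe_mul,
    Equiv.swap_mul_self, Equiv.Perm.coe_one, Function.comp_id]

section Saturated

variable {J : Type v} {K : Type w} {q : J → K} {X Y : Set ((Fin (d + 3) → Base.{u} m d) × J)}

/-- The sets of coloured sequences that are invariant under automorphisms, ignore the colour of
irregular sequences, and do not distinguish colours with the same image under `q`. -/
structure IsSaturated (q : J → K) (X : Set ((Fin (d + 3) → Base.{u} m d) × J)) : Prop where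
  smul_mem : ∀ (g : Base.Aut m d) u j, (u, j) ∈ X → (g • u, j) ∈ X
  irregular : ∀ u, (∀ σ, ¬ Regular σ u) → ∀ i j, (u, i) ∈ X → (u, j) ∈ X
  blur : ∀ u i j, q i = q j → (u, i) ∈ X → (u, j) ∈ X

namespace IsSaturated

theorem smul_mem_iff (h : IsSaturated q X) (g : Base.Aut m d) (u : Fin (d + 3) → Base.{u} m d)
    (j : J) : (g • u, j) ∈ X ↔ (u, j) ∈ X :=
  ⟨fun hu => inv_smul_smul g u ▸ h.smul_mem g⁻¹ _ j hu, h.smul_mem g u j⟩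

theorem mem_iff_of_irregular (h : IsSaturated q X) {u : Fin (d + 3) → Base.{u} m d}
    (hu : ∀ σ, ¬ Regular σ u) (i j : J) : (u, i) ∈ X ↔ (u, j) ∈ X :=
  ⟨h.irregular u hu i j, h.irregular u hu j i⟩

theorem mem_iff_of_regular (h : IsSaturated q X) {σ : Equiv.Perm (Fin (d + 3))}
    {u u' : Fin (d + 3) → Base.{u} m d} (hu : Regular σ u) (hu' : Regular σ u') {i j : J}
    (hij : q i = q j) : (u, i) ∈ X ↔ (u', j) ∈ X := by
  obtain ⟨g, rfl⟩ := hu.exists_smul_eq hu'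
  rw [h.smul_mem_iff]
  exact ⟨h.blur u i j hij, h.blur u j i hij.symm⟩

theorem union (hX : IsSaturated q X) (hY : IsSaturated q Y) : IsSaturated q (X ∪ Y) where
  smul_mem g u j := Or.imp (hX.smul_mem g u j) (hY.smul_mem g u j)
  irregular u hu i j := Or.imp (hX.irregular u hu i j) (hY.irregular u hu i j)
  blur u i j hij := Or.imp (hX.blur u i j hij) (hY.blur u i j hij)

theorem compl (hX : IsSaturated q X) : IsSaturated q Xᶜ where
  smul_mem g u j := mt (hX.smul_mem_iff g u j).1
  irregular u hu i j := mt (hX.irregular u hu j i)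
  blur u i j hij := mt (hX.blur u j i hij.symm)

end IsSaturated

/-- The subalgebra of the saturated sets. -/
def saturated (m d : ℕ) (q : J → K) :
    (polLang (d + 3)).Substructure (Set ((Fin (d + 3) → Base.{u} m d) × J)) where
  carrier := {X | IsSaturated q X}
  fun_mem f X hX := by
    cases f with
    | add => exact (hX 0).union (hX 1)
    | neg => exact (hX 0).compl
    | c i => exact
      { smul_mem := fun g u _ ⟨y, j, h⟩ =>
          ⟨g • y, j, Function.update_smul g u i y ▸ (hX 0).smul_mem g _ j h⟩
        irregular := fun _ _ _ _ h => h
        blur := fun _ _ _ _ h => h }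
    | d i j => exact
      { smul_mem := fun g _ _ => congrArg (g • ·)
        irregular := fun _ _ _ _ h => h
        blur := fun _ _ _ _ h => h }
    | p i j => exact
      { smul_mem := fun g u => (hX 0).smul_mem g (u ∘ Equiv.swap i j)
        irregular := fun _ hu => (hX 0).irregular _ fun _ h => hu _ h.of_comp_swap
        blur := fun u => (hX 0).blur (u ∘ Equiv.swap i j) }

end Saturated

section Representation

variable {J : Type v} {K : Type w} {N : Type u}

/-- The set of sequences of `N` whose image under `π`, with the colour given by `χ`, lies in `X`. -/
def represent (π : N → Base.{u} m d) (χ : (Fin (d + 3) → N) → J)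
    (X : Set ((Fin (d + 3) → Base.{u} m d) × J)) : Set (Fin (d + 3) → N) :=
  {v | (π ∘ v, χ v) ∈ X}

/-- Each orbit of regular sequences contains, up to `q`, every colour. -/
def Attains (q : J → K) (π : N → Base.{u} m d) (χ : (Fin (d + 3) → N) → J) : Prop :=
  ∀ σ (u : Fin (d + 3) → Base.{u} m d) c, Regular σ u → ∃ v, Regular σ (π ∘ v) ∧ q (χ v) = q c

/-- A regular sequence can be given every colour, up to `q`, by changing any single coordinate
without leaving its orbit. -/
def Rainbow (q : J → K) (π : N → Base.{u} m d) (χ : (Fin (d + 3) → N) → J) : Prop :=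
  ∀ σ v, Regular σ (π ∘ v) → ∀ i c,
    ∃ y, Regular σ (π ∘ Function.update v i y) ∧ q (χ (Function.update v i y)) = q c

variable {q : J → K} {π : N → Base.{u} m d} {χ : (Fin (d + 3) → N) → J}

theorem Rainbow.attains (hπ : Function.Surjective π) (h : Rainbow q π χ) : Attains q π χ := by
  intro σ u c hu
  obtain ⟨v, rfl⟩ := hπ.comp_left u
  obtain ⟨y, hy⟩ := h σ v hu 0 c
  exact ⟨_, hy⟩

theorem represent_injOn (hπ : Function.Surjective π) (hχ : Attains q π χ) :
    Set.InjOn (represent π χ) (saturated m d q) := by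
  intro X hX Y hY h
  ext ⟨u, j⟩
  by_cases hu : ∃ σ, Regular σ u
  · obtain ⟨σ, hσ⟩ := hu
    obtain ⟨v, hv, hj⟩ := hχ σ u j hσ
    rw [← hX.mem_iff_of_regular hv hσ hj, ← hY.mem_iff_of_regular hv hσ hj]
    exact Set.ext_iff.1 h v
  · push Not at hu
    obtain ⟨v, rfl⟩ := hπ.comp_left u
    rw [hX.mem_iff_of_irregular hu j (χ v), hY.mem_iff_of_irregular hu j (χ v)]
    exact Set.ext_iff.1 h v

theorem represent_cylindrification (hπ : Function.Surjective π) (hχ : Rainbow q π χ)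
    {X : Set ((Fin (d + 3) → Base.{u} m d) × J)} (hX : IsSaturated q X) (i : Fin (d + 3))
    (v : Fin (d + 3) → N) :
    (∃ y j, (Function.update (π ∘ v) i y, j) ∈ X) ↔
      ∃ y, Function.update v i y ∈ represent π χ X := by
  constructor
  · rintro ⟨y, j, h⟩
    obtain ⟨y, rfl⟩ := hπ y
    rw [← Function.comp_update] at h
    by_cases hr : ∃ σ, Regular σ (π ∘ Function.update v i y)
    · obtain ⟨σ, hσ⟩ := hr
      obtain ⟨y', hy', hj⟩ := hχ σ _ hσ i j
      rw [Function.update_idem] at hy' hj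
      exact ⟨y', (hX.mem_iff_of_regular hy' hσ hj).2 h⟩
    · push Not at hr
      exact ⟨y, hX.irregular _ hr j _ h⟩
  · rintro ⟨y, h⟩
    exact ⟨π y, χ (Function.update v i y), by rwa [← Function.comp_update]⟩

theorem holds_saturated_of_represent {e : Equation (polLang (d + 3))}
    (he : e ∈ pseTheory.{u} (d + 3)) (hπ : Function.Surjective π) (hχ : Attains q π χ)
    (hc : ∀ i, e.Uses (PolOp.c i) → Rainbow q π χ)
    (hd : ∀ i j, e.Uses (PolOp.d i j) → Function.Injective π)
    (hp : ∀ i j, e.Uses (PolOp.p i j) → ∀ v (σ : Equiv.Perm (Fin (d + 3))), χ (v ∘ σ) = χ v) :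
    Holds (saturated.{u} m d q) e := by
  refine (mem_pseTheory.1 he N).of_injective (represent_injOn hπ hχ).injective
    fun n f hf X => ?_
  cases f with
  | add => rfl
  | neg => rfl
  | c i =>
    ext v
    exact (represent_cylindrification hπ (hc i hf) (X 0).2 i v).trans mem_cylindrification.symm
  | d i j =>
    ext v
    exact (hd i j hf).eq_iff
  | p i j =>
    ext v
    refine Iff.trans ?_ mem_transposition.symm
    change (_, χ v) ∈ (X 0).1 ↔ (_, χ (v ∘ Equiv.swap i j)) ∈ (X 0).1
    rw [hp i j hf]
    rfl

theorem rainbow_id {χ : (Fin (d + 3) → Base.{u} m d) → J}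
    (hpoint : ∀ (σ : Equiv.Perm (Fin (d + 3))) (a b : ZMod m) x c, a ≠ b →
      ∃ a', a' ≠ b ∧ q (χ (canon a' b x ∘ σ)) = q c)
    (hlabel : ∀ (σ : Equiv.Perm (Fin (d + 3))) (a b : ZMod m) x c l, a ≠ b →
      ∃ y, q (χ (canon a b (Function.update x l y) ∘ σ)) = q c) :
    Rainbow q id χ := by
  rintro σ v ⟨a, b, x, hab, rfl : v = canon a b x ∘ σ⟩ i c
  obtain ⟨i, rfl⟩ := σ.symm.surjective i
  simp only [Function.id_comp, ← Function.update_comp_equiv]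
  induction i using Fin.cases with
  | zero =>
    obtain ⟨a', ha', hc⟩ := hpoint σ a b x c hab
    refine ⟨.point a', ?_⟩
    rw [update_canon_zero]
    exact ⟨regular_canon_comp ha' x, hc⟩
  | succ i =>
    induction i using Fin.cases with
    | zero =>
      obtain ⟨b', hb', hc⟩ := hpoint (Equiv.swap 0 1 * σ) b a x c hab.symm
      refine ⟨.point b', ?_⟩
      rw [Fin.succ_zero_eq_one, update_canon_one]
      rw [Equiv.Perm.coe_mul, ← Function.comp_assoc, canon_comp_swap] at hc
      exact ⟨regular_canon_comp hb'.symm x, hc⟩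
    | succ l =>
      obtain ⟨y, hc⟩ := hlabel σ a b x c l hab
      refine ⟨.label l y, ?_⟩
      rw [update_canon_label]
      exact ⟨regular_canon_comp hab _, hc⟩

end Representation

end Orbits

section Colours

variable {m d k : ℕ} {J : Type v} {K : Type w} {e : Equation (polLang (d + 3))}

theorem exists_sum_comp_update_eq {ι β G : Type*} [Fintype ι] [DecidableEq ι] [AddCommGroup G]
    {f : β → G} (hf : Function.Surjective f) (x : ι → β) (i : ι) (c : G) :
    ∃ y, ∑ j, f (Function.update x i y j) = c := by
  obtain ⟨y, hy⟩ := hf (c - ∑ j ∈ Finset.univ \ {i}, f (x j))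
  refine ⟨y, ?_⟩
  have hupdate : ∀ j, f (Function.update x i y j) = Function.update (f ∘ x) i (f y) j :=
    congrFun (Function.comp_update f x i y)
  simp only [hupdate, Finset.sum_update_of_mem (Finset.mem_univ i), hy, Function.comp_apply,
    sub_add_cancel]

theorem sum_canon_comp {G : Type*} [AddCommMonoid G] (f : Base.{u} m d → G)
    (σ : Equiv.Perm (Fin (d + 3))) (a b : ZMod m) (x : Fin (d + 1) → ℤ) :
    ∑ i, f ((canon a b x ∘ σ) i) =
      f (.point a) + (f (.point b) + ∑ l, f (.label l (x l))) := by
  refine (Equiv.sum_comp σ fun i => f (canon a b x i)).trans ?_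
  rw [Fin.sum_univ_succ, Fin.sum_univ_succ]
  rfl

theorem exists_twofold_surjection {β : Type*} [Fintype β] [Fintype K] [Nonempty K]
    (h : 2 * Fintype.card K ≤ Fintype.card β) :
    ∃ g : β → K, ∀ c b, ∃ b', b' ≠ b ∧ g b' = c := by
  obtain ⟨f⟩ := Function.Embedding.nonempty_of_card_le
    (α := K × Bool) (β := β) (by simpa [mul_comm] using h)
  have hf : ∀ p, Function.invFun f (f p) = p := Function.leftInverse_invFun f.injective
  refine ⟨fun b => (Function.invFun f b).1, fun c b => ?_⟩
  by_cases hb : f (c, true) = b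
  · exact ⟨f (c, false), fun h => by simpa using f.injective (h.trans hb.symm), by simp [hf]⟩
  · exact ⟨f (c, true), hb, by simp [hf]⟩

/-- The value of a point or label in `ZMod m`, where the value of a permutation is `0`. -/
def Base.value : Base.{u} m d → ZMod m
  | .point a => a
  | .perm _ => 0
  | .label _ x => x

theorem holds_saturated_of_two_mul_card_le [Fintype K] [Nonempty J] {q : J → K}
    (he : e ∈ pseTheory.{u} (d + 3)) (hK : 2 * Fintype.card K ≤ m) :
    Holds (saturated.{u} m d q) e := by
  have : Nonempty K := ⟨q (Classical.arbitrary J)⟩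
  have : NeZero m := ⟨by have := Fintype.card_pos (α := K); omega⟩
  obtain ⟨g, hg⟩ := exists_twofold_surjection (K := K) (β := ZMod m) (by rwa [ZMod.card])
  let χ : (Fin (d + 3) → Base.{u} m d) → J := fun u =>
    Function.invFun q (g (∑ i, (u i).value))
  have hχ : ∀ {u c}, g (∑ i, (u i).value) = q c → q (χ u) = q c := fun {u c} h => by
    simp only [χ, h, Function.invFun_eq (f := q) ⟨c, rfl⟩]
  have hrainbow : Rainbow q id χ := by
    refine rainbow_id (fun σ a b x c _ => ?_) fun σ a b x c l _ => ?_
    · let r : ZMod m := b + ∑ l, (x l : ZMod m)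
      obtain ⟨t, ht, htc⟩ := hg (q c) (b + r)
      refine ⟨t - r, fun h => ht (sub_eq_iff_eq_add.1 h), hχ ?_⟩
      rw [sum_canon_comp]
      exact (congrArg g (sub_add_cancel t r)).trans htc
    · obtain ⟨t, -, htc⟩ := hg (q c) 0
      obtain ⟨y, hy⟩ := exists_sum_comp_update_eq (ZMod.intCast_surjective (n := m)) x l (t - a - b)
      refine ⟨y, hχ ?_⟩
      rw [sum_canon_comp]
      simp only [Base.value, hy, add_sub_cancel, htc]
  refine holds_saturated_of_represent he Function.surjective_id
    (hrainbow.attains Function.surjective_id) (fun _ _ => hrainbow)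
    (fun _ _ _ => Function.injective_id) fun _ _ _ v σ => ?_
  exact congrArg (Function.invFun q ∘ g) (Equiv.sum_comp σ fun i => (v i).value)

theorem IsSaturated.of_exists_regular {X : Set ((Fin (d + 3) → Base.{u} m d) × J)} {q : J → K}
    (hX : IsSaturated (id : J → J) X)
    (hq : ∀ i j, q i = q j → ∀ σ, (∃ u, Regular σ u ∧ (u, i) ∈ X) →
      ∃ u, Regular σ u ∧ (u, j) ∈ X) : IsSaturated q X where
  smul_mem := hX.smul_mem
  irregular := hX.irregular
  blur u i j hij hu := by
    by_cases hr : ∃ σ, Regular σ u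
    · obtain ⟨σ, hσ⟩ := hr
      obtain ⟨u', hu', hj⟩ := hq i j hij σ ⟨u, hσ, hu⟩
      exact (hX.mem_iff_of_regular hu' hσ rfl).1 hj
    · push Not at hr
      exact hX.irregular u hr i j hu

open Nat in
theorem holds_saturated_of_card_vars_le [Nonempty J] {n : ℕ} (he : e ∈ pseTheory.{u} (d + 3))
    (hn : e.vars.card ≤ n) (hm : 2 * 2 ^ (n * (d + 3)!) ≤ m) :
    Holds (saturated.{u} m d (id : J → J)) e := by
  classical
  intro x
  let q : J → Set (e.vars × Equiv.Perm (Fin (d + 3))) := fun j =>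
    {p | ∃ u, Regular p.2 u ∧ (u, j) ∈ (x p.1).1}
  have hcard : 2 * Fintype.card (Set (e.vars × Equiv.Perm (Fin (d + 3)))) ≤ m := by
    refine le_trans ?_ hm
    simp only [Fintype.card_set, Fintype.card_prod, Fintype.card_coe, Fintype.card_perm,
      Fintype.card_fin]
    gcongr
    norm_num
  have hx : ∀ v ∈ e.vars, ((↑) ∘ x) v ∈ saturated.{u} m d q := fun v hv =>
    (x v).2.of_exists_regular fun i j hij σ => (Set.ext_iff.1 hij (⟨v, hv⟩, σ)).1
  have : Nonempty (saturated.{u} m d q) := ⟨⟨∅, by constructor <;> simp⟩⟩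
  refine Subtype.ext ?_
  rw [← realize_term_substructure, ← realize_term_substructure]
  exact (holds_saturated_of_two_mul_card_le he hcard).realize_eq_of_mem hx

theorem holds_saturated_of_not_uses_d (he : e ∈ pseTheory.{u} (d + 3))
    (hd : ∀ i j : Fin (d + 3), ¬ e.Uses (PolOp.d i j)) :
    Holds (saturated.{u} m d (id : ZMod k → ZMod k)) e := by
  let χ : (Fin (d + 3) → Base.{u} m d × ZMod k) → ZMod k := fun v => ∑ i, (v i).2
  have hrainbow : Rainbow id Prod.fst χ := by
    intro σ v hv i c
    obtain ⟨t, ht⟩ := exists_sum_comp_update_eq Function.surjective_id (Prod.snd ∘ v) i c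
    refine ⟨((v i).1, t), ?_, ?_⟩
    · have hfst : Prod.fst ∘ Function.update v i ((v i).1, t) = Prod.fst ∘ v :=
        (Function.comp_update Prod.fst v i _).trans (Function.update_eq_self i _)
      rwa [hfst]
    · refine Eq.trans (Finset.sum_congr rfl fun j _ => ?_) ht
      exact congrFun (Function.comp_update Prod.snd v i _) j
  exact holds_saturated_of_represent he Prod.fst_surjective
    (hrainbow.attains Prod.fst_surjective) (fun _ _ => hrainbow) (fun i j h => absurd h (hd i j))
    fun _ _ _ v σ => Equiv.sum_comp σ fun i => (v i).2

/-- The value of a label in `ZMod k`, where points and permutations have the value `0`. -/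
def Base.labelValue (k : ℕ) : Base.{u} m d → ZMod k
  | .point _ => 0
  | .perm _ => 0
  | .label _ x => x

theorem sum_labelValue_canon_comp (σ : Equiv.Perm (Fin (d + 3))) (a b : ZMod m)
    (x : Fin (d + 1) → ℤ) :
    ∑ i, ((canon.{u} a b x ∘ σ) i).labelValue k = ∑ l, (x l : ZMod k) := by
  rw [sum_canon_comp]
  simp only [Base.labelValue, zero_add]

theorem holds_saturated_of_not_uses_c (he : e ∈ pseTheory.{u} (d + 3))
    (hc : ∀ i : Fin (d + 3), ¬ e.Uses (PolOp.c i)) :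
    Holds (saturated.{u} m d (id : ZMod k → ZMod k)) e := by
  let χ : (Fin (d + 3) → Base.{u} m d) → ZMod k := fun u => ∑ i, (u i).labelValue k
  have hattains : Attains id id χ := by
    rintro σ - c ⟨a, b, x, hab, -⟩
    obtain ⟨y, hy⟩ := exists_sum_comp_update_eq (ZMod.intCast_surjective (n := k)) x 0 c
    exact ⟨_, regular_canon_comp hab (Function.update x 0 y),
      (sum_labelValue_canon_comp σ a b _).trans hy⟩
  exact holds_saturated_of_represent he Function.surjective_id hattains
    (fun i h => absurd h (hc i)) (fun _ _ _ => Function.injective_id)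
    fun _ _ _ v σ => Equiv.sum_comp σ fun i => (v i).labelValue k

/-- The difference of two points, where the other pairs have the difference `0`. -/
def Base.difference : Base.{u} m d → Base.{u} m d → ZMod m
  | .point a, .point b => b - a
  | _, _ => 0

/-- The sum of the differences of the pairs of points in a sequence, each pair taken in the order of
its coordinates. Transpositions may change the sign of this colour. -/
def orientedDifference (u : Fin (d + 3) → Base.{u} m d) : ZMod m :=
  ∑ i, ∑ j, if i < j then (u i).difference (u j) else 0

theorem orientedDifference_canon_comp (σ : Equiv.Perm (Fin (d + 3))) (a b : ZMod m)
    (x : Fin (d + 1) → ℤ) :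
    orientedDifference (canon.{u} a b x ∘ σ) =
      if σ.symm 0 < σ.symm 1 then b - a else a - b := by
  let f : Fin (d + 3) → Fin (d + 3) → ZMod m := fun i j =>
    if σ.symm i < σ.symm j then (canon.{u} a b x i).difference (canon a b x j) else 0
  have hne : σ.symm 0 ≠ σ.symm 1 := σ.symm.injective.ne Fin.zero_ne_one
  calc orientedDifference (canon.{u} a b x ∘ σ)
      = ∑ i, ∑ j, f (σ i) (σ j) := by
        simp only [f, orientedDifference, Function.comp_apply, Equiv.symm_apply_apply]
    _ = ∑ i, ∑ j, f i j := by
        rw [Equiv.sum_comp σ fun i => ∑ j, f i (σ j)]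
        exact Finset.sum_congr rfl fun i _ => Equiv.sum_comp σ (f i)
    _ = f 0 1 + f 1 0 := by
        simp [f, Fin.sum_univ_succ, canon, Base.difference]
    _ = if σ.symm 0 < σ.symm 1 then b - a else a - b := by
        rcases lt_or_gt_of_ne hne with h | h <;>
          simp [f, h, h.not_gt, canon, Base.difference]

theorem exists_ne_zero_val_eq [NeZero k] (c : ZMod k) :
    ∃ t : ZMod (k + 1), t ≠ 0 ∧ (t.val : ZMod k) = c := by
  have hval : (((c - 1).val + 1 : ℕ) : ZMod (k + 1)).val = (c - 1).val + 1 :=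
    ZMod.val_natCast_of_lt (Nat.succ_lt_succ (c - 1).val_lt)
  refine ⟨((c - 1).val + 1 : ℕ), fun h => ?_, ?_⟩
  · rw [h, ZMod.val_zero] at hval
    exact absurd hval.symm (Nat.succ_ne_zero _)
  · rw [hval, Nat.cast_succ, ZMod.natCast_zmod_val, sub_add_cancel]

theorem holds_saturated_of_not_uses_p [NeZero k] (he : e ∈ pseTheory.{u} (d + 3))
    (hp : ∀ i j : Fin (d + 3), ¬ e.Uses (PolOp.p i j)) :
    Holds (saturated.{u} (k + 1) d (id : ZMod k → ZMod k)) e := by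
  let χ : (Fin (d + 3) → Base.{u} (k + 1) d) → ZMod k := fun u =>
    (orientedDifference u).val + ∑ i, (u i).labelValue k
  have hχ : ∀ (σ : Equiv.Perm (Fin (d + 3))) (a b : ZMod (k + 1)) x, χ (canon a b x ∘ σ) =
      (if σ.symm 0 < σ.symm 1 then b - a else a - b).val + ∑ l, (x l : ZMod k) :=
    fun σ a b x => by
      simp only [χ, orientedDifference_canon_comp, sum_labelValue_canon_comp]
  have hrainbow : Rainbow id id χ := by
    refine rainbow_id (fun σ a b x c _ => ?_) fun σ a b x c l _ => ?_
    · obtain ⟨t, ht, htc⟩ := exists_ne_zero_val_eq (c - ∑ l, (x l : ZMod k))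
      simp only [hχ, id_eq, ← eq_sub_iff_add_eq, ← htc]
      split_ifs
      · exact ⟨b - t, fun h => ht (sub_eq_self.1 h), by rw [sub_sub_cancel]⟩
      · exact ⟨b + t, fun h => ht (add_eq_left.1 h), by rw [add_sub_cancel_left]⟩
    · simp only [hχ, id_eq, ← eq_sub_iff_add_eq']
      exact exists_sum_comp_update_eq ZMod.intCast_surjective x l _
  exact holds_saturated_of_represent he Function.surjective_id
    (hrainbow.attains Function.surjective_id) (fun _ _ => hrainbow)
    (fun _ _ _ => Function.injective_id) fun i j h => absurd h (hp i j)

end Colours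

theorem holds_of_holds_coloured {α : ℕ} {U : Type u} {e : Equation (polLang α)}
    (he : Holds (Set ((Fin α → U) × Unit)) e) : Holds (Set (Fin α → U)) e := by
  refine he.of_injective (φ := (Prod.fst ⁻¹' ·)) Prod.fst_surjective.preimage_injective
    fun n f _ X => ?_
  cases f with
  | c i =>
    ext ⟨u, -⟩
    exact mem_cylindrification.trans (exists_congr fun y => (exists_const Unit).symm)
  | p i j => exact Set.ext fun p => mem_transposition
  | _ => rfl

section Terms

variable {α : ℕ}

/-- The sum `s + t`. -/
def addTerm (s t : (polLang α).Term ℕ) : (polLang α).Term ℕ := .func PolOp.add ![s, t]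

/-- The complement `-t`. -/
def negTerm (t : (polLang α).Term ℕ) : (polLang α).Term ℕ := .func PolOp.neg ![t]

/-- The cylindrification `c_i t`. -/
def cylTerm (i : Fin α) (t : (polLang α).Term ℕ) : (polLang α).Term ℕ := .func (PolOp.c i) ![t]

/-- The diagonal constant `d_ij`. -/
def diagTerm (i j : Fin α) : (polLang α).Term ℕ := .func (PolOp.d i j) ![]

/-- The transposition `p_ij t`. -/
def transTerm (i j : Fin α) (t : (polLang α).Term ℕ) : (polLang α).Term ℕ :=
  .func (PolOp.p i j) ![t]

/-- The product `s · t`. -/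
def mulTerm (s t : (polLang α).Term ℕ) : (polLang α).Term ℕ :=
  negTerm (addTerm (negTerm s) (negTerm t))

/-- The sum of a list of terms. The empty sum is written with a variable because the signature has
no constant for the empty set. -/
def sumTerm (l : List ((polLang α).Term ℕ)) : (polLang α).Term ℕ :=
  l.foldr addTerm (mulTerm (.var 0) (negTerm (.var 0)))

variable {M : Type u} {J : Type v} {x : ℕ → Set ((Fin α → M) × J)} {s t : (polLang α).Term ℕ}
  {p : (Fin α → M) × J} {i j : Fin α}

theorem mem_addTerm : p ∈ (addTerm s t).realize x ↔ p ∈ s.realize x ∨ p ∈ t.realize x := Iff.rfl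

theorem mem_negTerm : p ∈ (negTerm t).realize x ↔ p ∉ t.realize x := Iff.rfl

theorem mem_cylTerm :
    p ∈ (cylTerm i t).realize x ↔ ∃ y l, (Function.update p.1 i y, l) ∈ t.realize x := Iff.rfl

theorem mem_diagTerm : p ∈ (diagTerm i j).realize x ↔ p.1 i = p.1 j := Iff.rfl

theorem mem_transTerm :
    p ∈ (transTerm i j t).realize x ↔ (p.1 ∘ Equiv.swap i j, p.2) ∈ t.realize x := Iff.rfl

theorem mem_mulTerm : p ∈ (mulTerm s t).realize x ↔ p ∈ s.realize x ∧ p ∈ t.realize x := by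
  simp only [mulTerm, mem_negTerm, mem_addTerm, not_or, not_not]

theorem mem_sumTerm {l : List ((polLang α).Term ℕ)} :
    p ∈ (sumTerm l).realize x ↔ ∃ t ∈ l, p ∈ t.realize x := by
  induction l with
  | nil => simp [sumTerm, mem_mulTerm, mem_negTerm]
  | cons t l ih =>
    rw [List.exists_mem_cons_iff]
    exact or_congr_right ih

end Terms

section Inclusions

variable {d k : ℕ}

/-- The pairs `(s, t)` whose inclusions `s ≤ t` say that the variables below `k` are the classes of
a proper edge colouring, in the first two coordinates, in which a vertex reached by one colour is
reached by every colour, and that for some value of coordinate `1` the next `k + 1` variables cover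
the vertices, with one vertex each. -/
def colouringInclusions (d k : ℕ) :
    List ((polLang (d + 3)).Term ℕ × (polLang (d + 3)).Term ℕ) :=
  ((List.range k).flatMap fun l =>
    ((List.range l).map fun l' => (.var l, negTerm (.var l'))) ++
    ((List.range k).map fun l' => (.var l, cylTerm 0 (.var l'))) ++
    [(.var l, negTerm (diagTerm 0 1)), (.var l, transTerm 0 1 (.var l))]) ++
  ((List.range (k + 1)).flatMap fun i =>
    [(cylTerm 2 (.var (k + i)), .var (k + i)),
      (mulTerm (.var (k + i)) (transTerm 0 2 (.var (k + i))), diagTerm 0 2)]) ++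
  [(.var 0, cylTerm 1 (negTerm (cylTerm 0 (mulTerm (cylTerm 1 (.var 0))
    (negTerm (sumTerm ((List.range (k + 1)).map fun i => .var (k + i))))))))]

theorem forall_mem_colouringInclusions
    {P : (polLang (d + 3)).Term ℕ × (polLang (d + 3)).Term ℕ → Prop} :
    (∀ q ∈ colouringInclusions d k, P q) ↔
      (∀ l < k, (∀ l' < l, P (.var l, negTerm (.var l'))) ∧
        (∀ l' < k, P (.var l, cylTerm 0 (.var l'))) ∧
        P (.var l, negTerm (diagTerm 0 1)) ∧ P (.var l, transTerm 0 1 (.var l))) ∧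
      (∀ i < k + 1, P (cylTerm 2 (.var (k + i)), .var (k + i)) ∧
        P (mulTerm (.var (k + i)) (transTerm 0 2 (.var (k + i))), diagTerm 0 2)) ∧
      P (.var 0, cylTerm 1 (negTerm (cylTerm 0 (mulTerm (cylTerm 1 (.var 0))
        (negTerm (sumTerm ((List.range (k + 1)).map fun i => .var (k + i)))))))) := by
  simp only [colouringInclusions, List.forall_mem_append, List.forall_mem_flatMap,
    List.forall_mem_map, List.forall_mem_cons, List.not_mem_nil, IsEmpty.forall_iff, implies_true,
    List.mem_range, and_true, and_assoc]

/-- The sequences that, up to the first three coordinates, violate some inclusion. -/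
def defectTerm (d k : ℕ) : (polLang (d + 3)).Term ℕ :=
  cylTerm 0 (cylTerm 1 (cylTerm 2
    (sumTerm ((colouringInclusions d k).map fun q => mulTerm q.1 (negTerm q.2)))))

/-- The equation saying that the first variable is empty up to defects. -/
def colouringEquation (d k : ℕ) : Equation (polLang (d + 3)) :=
  ⟨addTerm (.var 0) (defectTerm d k), defectTerm d k⟩

theorem mem_defectTerm {M : Type u} {J : Type v} {x : ℕ → Set ((Fin (d + 3) → M) × J)}
    {p : (Fin (d + 3) → M) × J} :
    p ∈ (defectTerm d k).realize x ↔ ∃ a b c j, ∃ q ∈ colouringInclusions d k,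
      (Function.update (Function.update (Function.update p.1 0 a) 1 b) 2 c, j) ∈ q.1.realize x ∧
      (Function.update (Function.update (Function.update p.1 0 a) 1 b) 2 c, j) ∉
        q.2.realize x := by
  have : Nonempty J := ⟨p.2⟩
  simp only [defectTerm, mem_cylTerm, mem_sumTerm, List.mem_map, exists_exists_and_eq_and,
    mem_mulTerm, mem_negTerm, exists_const]

end Inclusions

section Soundness

variable {d k : ℕ} {U : Type u}

/-- The sequence that starts with `a, b, c` and continues with `w`. -/
def cons₃ (a b c : U) (w : Fin d → U) : Fin (d + 3) → U :=
  Fin.cons a (Fin.cons b (Fin.cons c w))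

theorem eq_cons₃ (u : Fin (d + 3) → U) : ∃ a b c w, u = cons₃ a b c w :=
  ⟨u 0, u 1, u 2, fun i => u i.succ.succ.succ,
    funext (Fin.cases rfl (Fin.cases rfl (Fin.cases rfl fun _ => rfl)))⟩

variable (a b c y : U) (w : Fin d → U)

theorem update_cons₃_zero : Function.update (cons₃ a b c w) 0 y = cons₃ y b c w :=
  Fin.update_cons_zero _ _ _

theorem update_cons₃_one : Function.update (cons₃ a b c w) 1 y = cons₃ a y c w :=
  (Fin.cons_update _ _ 0 _).symm.trans (congrArg _ (Fin.update_cons_zero _ _ _))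

theorem update_cons₃_two : Function.update (cons₃ a b c w) 2 y = cons₃ a b y w :=
  (Fin.cons_update _ _ 1 _).symm.trans (congrArg _
    ((Fin.cons_update _ _ 0 _).symm.trans (congrArg _ (Fin.update_cons_zero _ _ _))))

theorem cons₃_comp_swap_zero_one : cons₃ a b c w ∘ Equiv.swap 0 1 = cons₃ b a c w := by
  rw [Equiv.comp_swap_eq_update]
  exact (congrArg (Function.update · 0 _) (update_cons₃_one a b c a w)).trans
    (update_cons₃_zero a a c b w)

theorem cons₃_comp_swap_zero_two : cons₃ a b c w ∘ Equiv.swap 0 2 = cons₃ c b a w := by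
  rw [Equiv.comp_swap_eq_update]
  exact (congrArg (Function.update · 0 _) (update_cons₃_two a b c a w)).trans
    (update_cons₃_zero a b a c w)

variable {a b c w}

theorem exists_isBoundedColouring {x : ℕ → Set ((Fin (d + 3) → U) × Unit)}
    (hx : ∀ q ∈ colouringInclusions d k, ∀ a b c,
      (cons₃ a b c w, ()) ∈ q.1.realize x → (cons₃ a b c w, ()) ∈ q.2.realize x)
    (h0 : (cons₃ a b c w, ()) ∈ x 0) :
    ∃ z, IsBoundedColouring k (fun l a b => (cons₃ a b c w, ()) ∈ x l)
      (fun i a => (cons₃ a z c w, ()) ∈ x (k + i)) := by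
  simp only [forall_mem_colouringInclusions, mem_cylTerm, mem_negTerm, mem_mulTerm, mem_transTerm,
    mem_diagTerm, mem_sumTerm, List.mem_map, exists_exists_and_eq_and, List.mem_range,
    Term.realize_var, update_cons₃_zero, update_cons₃_one, update_cons₃_two,
    cons₃_comp_swap_zero_one, cons₃_comp_swap_zero_two, Unique.exists_iff,
    PUnit.default_eq_unit] at hx
  obtain ⟨hR, hT, hbounded⟩ := hx
  obtain ⟨z, hz⟩ := hbounded a b c h0
  refine ⟨z, ?_⟩
  exact
    { disjoint := fun l hl l' hl' a b => (hR l hl).1 l' hl' a b c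
      complete := fun l hl l' hl' a b => (hR l hl).2.1 l' hl' a b c
      irrefl := fun l hl a b => (hR l hl).2.2.1 a b c
      symm := fun l hl a b => (hR l hl).2.2.2 a b c
      subsingleton := fun i hi a a' h h' =>
        (hT i hi).2 a z a' ⟨(hT i hi).1 a z a' ⟨c, h⟩, (hT i hi).1 a' z a ⟨c, h'⟩⟩
      bounded := fun a b h => by
        by_contra! hcover
        exact hz ⟨a, ⟨b, h⟩, fun ⟨i, hi, h'⟩ => hcover i hi h'⟩ }

theorem colouringEquation_mem_pseTheory (hk : Even k) (hk0 : k ≠ 0) :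
    colouringEquation d k ∈ pseTheory.{u} (d + 3) := by
  refine mem_pseTheory.2 fun U => holds_of_holds_coloured fun x => Set.union_eq_right.2 ?_
  rintro ⟨u, ⟨⟩⟩ hu
  obtain ⟨a, b, c, w, rfl⟩ := eq_cons₃ u
  by_contra hdefect
  obtain ⟨z, hz⟩ := exists_isBoundedColouring (k := k) (x := x) (w := w)
    (fun q hq a' b' c' hs => by
      by_contra ht
      refine hdefect (mem_defectTerm.2 ⟨a', b', c', (), q, hq, ?_⟩)
      simp only [update_cons₃_zero, update_cons₃_one, update_cons₃_two]
      exact ⟨hs, ht⟩) hu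
  exact hz.not_rel hk hk0 a b hu

end Soundness

section Counterexample

variable {m d k : ℕ} {J : Type v} {p : (Fin (d + 3) → Base.{u} m d) × J} {i j : J} {a a' : ZMod m}
  {y : Base.{u} m d}

theorem fin_zero_ne_two : (0 : Fin (d + 3)) ≠ 2 := (Fin.succ_ne_zero (1 : Fin (d + 2))).symm

theorem fin_one_ne_two : (1 : Fin (d + 3)) ≠ 2 :=
  (Fin.succ_injective (d + 2)).ne (Fin.zero_ne_one (n := d))

/-- The set of sequences of two distinct points and a label of each sort that have the colour `j`,
regarded as the class of edges of colour `j`. -/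
def colourClass (m d : ℕ) (j : J) : Set ((Fin (d + 3) → Base.{u} m d) × J) :=
  {p | Regular 1 p.1 ∧ p.2 = j}

/-- The set of sequences that start with a point and a permutation that moves this point to `a`.
When the permutation is fixed, it contains a single point. -/
def pointClass (d : ℕ) (J : Type v) (a : ZMod m) : Set ((Fin (d + 3) → Base.{u} m d) × J) :=
  {p | ∃ b z, p.1 0 = .point b ∧ p.1 1 = .perm z ∧ z b = a}

theorem colourClass_mem_saturated (j : J) :
    colourClass.{u} m d j ∈ saturated m d (id : J → J) where
  smul_mem g _ _ h := ⟨h.1.smul g, h.2⟩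
  irregular _ hu _ _ h := absurd h.1 (hu 1)
  blur _ _ _ hij h := ⟨h.1, hij.symm.trans h.2⟩

theorem pointClass_mem_saturated (a : ZMod m) :
    pointClass.{u} d J a ∈ saturated m d (id : J → J) where
  smul_mem := by
    rintro g u j ⟨b, z, h0, h1, rfl⟩
    exact ⟨g.1 b, z * g.1⁻¹, congrArg (g • ·) h0, congrArg (g • ·) h1, by simp⟩
  irregular _ _ _ _ h := h
  blur _ _ _ _ h := h

theorem notMem_colourClass_of_ne (h : p ∈ colourClass m d i) (hij : i ≠ j) :
    p ∉ colourClass m d j :=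
  fun h' => hij (h.2.symm.trans h'.2)

theorem mk_mem_colourClass (h : p ∈ colourClass m d i) : (p.1, j) ∈ colourClass m d j :=
  ⟨h.1, rfl⟩

theorem apply_zero_ne_apply_one_of_mem_colourClass (h : p ∈ colourClass m d i) :
    p.1 0 ≠ p.1 1 := by
  obtain ⟨⟨a, b, x, hab, hp⟩, -⟩ := h
  rw [hp]
  exact fun h => hab (Base.point.inj h)

theorem comp_swap_mem_colourClass (h : p ∈ colourClass m d i) :
    (p.1 ∘ Equiv.swap 0 1, p.2) ∈ colourClass m d i := by
  obtain ⟨⟨a, b, x, hab, hp⟩, hi⟩ := h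
  refine ⟨⟨b, a, x, hab.symm, ?_⟩, hi⟩
  rw [hp]
  exact canon_comp_swap a b x

theorem mem_pointClass_of_update_two (h : (Function.update p.1 2 y, j) ∈ pointClass d J a) :
    p ∈ pointClass d J a := by
  obtain ⟨b, z, h0, h1, hz⟩ := h
  exact ⟨b, z, (Function.update_of_ne fin_zero_ne_two y p.1).symm.trans h0,
    (Function.update_of_ne fin_one_ne_two y p.1).symm.trans h1, hz⟩

theorem apply_zero_eq_apply_two_of_mem_pointClass (h : p ∈ pointClass d J a)
    (h' : (p.1 ∘ Equiv.swap 0 2, p.2) ∈ pointClass d J a) : p.1 0 = p.1 2 := by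
  obtain ⟨b, z, h0, h1, hz⟩ := h
  obtain ⟨b', z', h0', h1', hz'⟩ := h'
  have h12 : p.1 (Equiv.swap 0 2 1) = .perm z' := h1'
  rw [Equiv.swap_apply_of_ne_of_ne Fin.zero_ne_one.symm fin_one_ne_two, h1] at h12
  obtain rfl := Base.perm.inj h12
  obtain rfl := z.injective (hz.trans hz'.symm)
  have h02 : p.1 (Equiv.swap 0 2 0) = .point b := h0'
  rw [Equiv.swap_apply_left] at h02
  exact h0.trans h02.symm

theorem exists_mem_pointClass (hp : p.1 1 = .perm 1)
    (h : (Function.update p.1 1 y, j) ∈ colourClass m d i) : ∃ a, p ∈ pointClass d J a := by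
  obtain ⟨⟨a, b, x, -, hu⟩, -⟩ := h
  refine ⟨a, a, 1, ?_, hp, rfl⟩
  rw [← Function.update_of_ne (Fin.zero_ne_one (n := d + 1)) y p.1]
  exact congrFun hu 0

/-- The assignment that violates `colouringEquation d k`. Its edge colouring has `k + 1` points, of
which the variables from `k` on contain one each. -/
def colouringValuation (d k n : ℕ) : Set ((Fin (d + 3) → Base.{u} (k + 1) d) × ZMod k) :=
  if n < k then colourClass (k + 1) d (n : ZMod k)
  else pointClass d (ZMod k) ((n - k : ℕ) : ZMod (k + 1))

theorem colouringValuation_mem_saturated (n : ℕ) :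
    colouringValuation.{u} d k n ∈ saturated (k + 1) d (id : ZMod k → ZMod k) := by
  unfold colouringValuation
  split_ifs
  · exact colourClass_mem_saturated _
  · exact pointClass_mem_saturated _

theorem colouringValuation_of_lt {l : ℕ} (hl : l < k) :
    colouringValuation.{u} d k l = colourClass (k + 1) d (l : ZMod k) :=
  if_pos hl

theorem colouringValuation_add (i : ℕ) :
    colouringValuation.{u} d k (k + i) = pointClass d (ZMod k) (i : ZMod (k + 1)) := by
  rw [colouringValuation, if_neg (Nat.not_lt.2 (Nat.le_add_right k i)), Nat.add_sub_cancel_left]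

theorem natCast_ne_natCast_of_lt {l l' : ℕ} (hl : l < k) (hl' : l' < l) :
    (l : ZMod k) ≠ (l' : ZMod k) := fun h => by
  have := congrArg ZMod.val h
  rw [ZMod.val_natCast_of_lt hl, ZMod.val_natCast_of_lt (hl'.trans hl)] at this
  exact hl'.ne this.symm

theorem realize_colouringValuation_subset (hk0 : k ≠ 0) :
    ∀ q ∈ colouringInclusions d k, q.1.realize (colouringValuation.{u} d k) ⊆
      q.2.realize (colouringValuation d k) := by
  simp only [forall_mem_colouringInclusions, Set.subset_def, mem_cylTerm, mem_negTerm, mem_mulTerm,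
    mem_transTerm, mem_diagTerm, mem_sumTerm, List.mem_map, exists_exists_and_eq_and,
    List.mem_range, Term.realize_var, colouringValuation_add]
  refine ⟨fun l hl => ?_, fun i _ => ?_, fun p _ => ?_⟩
  · rw [colouringValuation_of_lt hl]
    refine ⟨fun l' hl' p h => ?_, fun l' hl' p h => ?_, fun p =>
      apply_zero_ne_apply_one_of_mem_colourClass, fun p => comp_swap_mem_colourClass⟩
    · rw [colouringValuation_of_lt (hl'.trans hl)]
      exact notMem_colourClass_of_ne h (natCast_ne_natCast_of_lt hl hl')
    · rw [colouringValuation_of_lt hl']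
      refine ⟨p.1 0, l', ?_⟩
      rw [Function.update_eq_self]
      exact mk_mem_colourClass h
  · exact ⟨fun p ⟨y, j, h⟩ => mem_pointClass_of_update_two h,
      fun p h => apply_zero_eq_apply_two_of_mem_pointClass h.1 h.2⟩
  · refine ⟨.perm 1, p.2, ?_⟩
    rintro ⟨b, j, ⟨b', j', h⟩, hcover⟩
    rw [colouringValuation_of_lt (Nat.pos_of_ne_zero hk0)] at h
    have h1 : Function.update (Function.update p.1 1 (.perm 1)) 0 b 1 = .perm 1 := by
      rw [Function.update_of_ne Fin.zero_ne_one.symm, Function.update_self]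
    obtain ⟨a, ha⟩ := exists_mem_pointClass (p := (_, j)) h1 h
    exact hcover ⟨a.val, a.val_lt, by rwa [ZMod.natCast_zmod_val]⟩

theorem not_holds_colouringEquation (hk0 : k ≠ 0) :
    ¬ Holds (saturated.{u} (k + 1) d (id : ZMod k → ZMod k)) (colouringEquation d k) := by
  intro h
  have : Fact (1 < k + 1) := ⟨Nat.succ_lt_succ (Nat.pos_of_ne_zero hk0)⟩
  have heq := congrArg Subtype.val (h fun n => ⟨_, colouringValuation_mem_saturated n⟩)
  rw [← realize_term_substructure, ← realize_term_substructure] at heq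
  have hmem : (canon 0 1 0, 0) ∈ colouringValuation.{u} d k 0 := by
    rw [colouringValuation_of_lt (Nat.pos_of_ne_zero hk0)]
    exact ⟨⟨0, 1, 0, zero_ne_one, rfl⟩, Nat.cast_zero.symm⟩
  obtain ⟨a, b, c, j, q, hq, hs, ht⟩ := mem_defectTerm.1 (Set.union_eq_right.1 heq hmem)
  exact ht (realize_colouringValuation_subset hk0 q hq hs)

end Counterexample

open Nat in
theorem exists_complex_axiom (d : ℕ) {E : Set (Equation (polLang (d + 3)))}
    (hE : IsEquationalAxiomSet.{u} (d + 3) E) (n : ℕ) :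
    ∃ e ∈ E, n < e.vars.card ∧ (∃ i j : Fin (d + 3), e.Uses (PolOp.p i j)) ∧
      (∃ i j : Fin (d + 3), e.Uses (PolOp.d i j)) ∧ ∃ i : Fin (d + 3), e.Uses (PolOp.c i) := by
  by_contra! hsimple
  let k := 2 ^ (n * (d + 3)! + 1)
  have hk : Even k := even_pow.2 ⟨even_two, succ_ne_zero _⟩
  have hk0 : k ≠ 0 := pow_ne_zero _ two_ne_zero
  have hn : 2 * 2 ^ (n * (d + 3)!) ≤ k + 1 := (pow_succ' 2 _).symm.le.trans (le_succ k)
  have : NeZero k := ⟨hk0⟩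
  have hholds : ∀ e ∈ E, Holds (saturated.{u} (k + 1) d (id : ZMod k → ZMod k)) e := by
    intro e he
    have heT := hE.1 he
    by_cases hcard : n < e.vars.card
    · by_cases hp : ∃ i j : Fin (d + 3), e.Uses (PolOp.p i j)
      · by_cases hd : ∃ i j : Fin (d + 3), e.Uses (PolOp.d i j)
        · exact holds_saturated_of_not_uses_c heT (hsimple e he hcard hp hd)
        · push Not at hd
          exact holds_saturated_of_not_uses_d heT hd
      · push Not at hp
        exact holds_saturated_of_not_uses_p heT hp
    · exact holds_saturated_of_card_vars_le heT (not_lt.1 hcard) hn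
  exact not_holds_colouringEquation hk0
    ((hE.2 _ (colouringEquation_mem_pseTheory hk hk0)).realize_eq hholds)

theorem not_termUses_p_onTerm {α : ℕ} (i j : Fin α) (t : (cylLang α).Term ℕ) :
    ¬ TermUses (L := polLang α) (PolOp.p i j) ((cylToPol α).onTerm t) := by
  induction t with
  | var => exact id
  | func f ts ih =>
    rintro (h | ⟨l, h⟩)
    · have h' : (⟨_, (cylToPol α).onFunction f⟩ : Σ n, PolOp α n) = ⟨1, .p i j⟩ := h
      cases f <;> cases h'
    · exact ih l h

theorem not_finitelyAxiomatizableOverCs (d : ℕ) :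
    ¬ FinitelyAxiomatizableOverCs.{u} (d + 3) := by
  rintro ⟨F, hF, h⟩
  have hE : IsEquationalAxiomSet.{u} (d + 3)
      (F ∪ Equation.map (cylToPol (d + 3)) '' csTheory.{u} (d + 3)) :=
    ⟨fun e he => (h e).2 (Derives.ax e he), fun e he => (h e).1 he⟩
  obtain ⟨n, hn⟩ := (hF.image fun e => e.vars.card).bddAbove
  obtain ⟨e, he, hcard, ⟨i, j, hp⟩, -⟩ := exists_complex_axiom d hE n
  rcases he with he | ⟨e, -, rfl⟩
  · exact absurd (hn ⟨e, he, rfl⟩) (not_le.2 hcard)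
  · exact hp.elim (not_termUses_p_onTerm i j _) (not_termUses_p_onTerm i j _)

end SetAlgebra

theorem theorem2 (α : ℕ) (hα : 3 ≤ α) :
    (∀ E : Set (EqLogic.Equation (SetAlgebra.polLang α)),
      SetAlgebra.IsEquationalAxiomSet.{u} α E →
        ∃ e : ℕ → EqLogic.Equation (SetAlgebra.polLang α), ∀ n : ℕ,
          e n ∈ E ∧ n < (e n).vars.card ∧
          (∃ i j : Fin α, (e n).Uses (SetAlgebra.PolOp.p i j)) ∧
          (∃ k l : Fin α, (e n).Uses (SetAlgebra.PolOp.d k l)) ∧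
          (∃ m : Fin α, (e n).Uses (SetAlgebra.PolOp.c m))) ∧
    ¬ SetAlgebra.FinitelyAxiomatizableOverCs.{u} α := by
  obtain ⟨d, rfl⟩ := Nat.exists_eq_add_of_le' hα
  refine ⟨fun E hE => ?_, SetAlgebra.not_finitelyAxiomatizableOverCs d⟩
  choose e he using fun n => SetAlgebra.exists_complex_axiom d hE n
  exact ⟨e, he⟩
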